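/- Let $n\ge 0$ be an integer, and let $\mathbb{M}_Z^n$ be $\mathbb{R}^n$ with the norm \[ \|(x(1),\dots,x(n))\| = \max_{x(i)\ge 0} x(i) - \min_{x(i)\le 0} x(i), \] where a maximum or minimum over an empty set of indices counts as $0$; its unit ball is $\operatorname{conv}([0,1]^n\cup[-1,0]^n)$. A Steiner tree of a finite set $N$ of points is a tree whose vertex set is a finite set of points of the space that contains $N$; its length is the sum of $\|x-y\|$ over its edges $xy$; and a Steiner minimal tree (SMT) of $N$ is a Steiner tree of $N$ of minimum length among all Steiner trees of $N$. Write $o$ for the origin. For a finite set $A$ of nonzero points, the star joining $o$ to $A$ is the tree with vertex set $A\cup\{o\}$ whose edges are the pairs $\{o,a\}$, $a\in A$. Let $A$ be any finite set of nonzero points of $\mathbb{M}_Z^n$. Then the star joining $o$ to $A$ is an SMT of $A\cup\{o\}$ if and only if, for every subset $B\subseteq A$ with at most $4$ elements, the star joining $o$ to $B$ is an SMT of $B\cup\{o\}$. -/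

import Mathlib

/-- The real vector space `ℝⁿ` underlying the Minkowski space `M_Z^n`.  It is a separate type, so
that it can carry a norm other than the one of `Fin n → ℝ`. -/
def MZ (n : ℕ) : Type := Fin n → ℝ

namespace MZ

variable {n : ℕ}

noncomputable instance : AddCommGroup (MZ n) := inferInstanceAs (AddCommGroup (Fin n → ℝ))

noncomputable instance : Module ℝ (MZ n) := inferInstanceAs (Module ℝ (Fin n → ℝ))

/-- The norm `‖x‖ = max_{x i ≥ 0} x i - min_{x i ≤ 0} x i` of `M_Z^n`, where a maximum or a minimum
over no index at all counts as `0`.  The first summand is the largest nonnegative coordinate, and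
the second one is minus the smallest nonpositive coordinate. -/
noncomputable instance : Norm (MZ n) :=
  ⟨fun x : Fin n → ℝ => (⨆ i, max (x i) 0) + ⨆ i, max (-x i) 0⟩

theorem norm_def (x : MZ n) :
    ‖x‖ = (⨆ i : Fin n, max ((x : Fin n → ℝ) i) 0) + ⨆ i : Fin n, max (-(x : Fin n → ℝ) i) 0 :=
  rfl

theorem le_iSup_max (f : Fin n → ℝ) (i : Fin n) : max (f i) 0 ≤ ⨆ j, max (f j) 0 :=
  le_ciSup (f := fun j => max (f j) 0) (Set.finite_range _).bddAbove i

theorem iSup_max_nonneg (f : Fin n → ℝ) : 0 ≤ ⨆ j, max (f j) 0 :=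
  Real.iSup_nonneg fun _ => le_max_right _ _

theorem iSup_max_add_le (f g : Fin n → ℝ) :
    (⨆ j, max (f j + g j) 0) ≤ (⨆ j, max (f j) 0) + ⨆ j, max (g j) 0 := by
  refine Real.iSup_le (fun i => ?_) (add_nonneg (iSup_max_nonneg f) (iSup_max_nonneg g))
  have hf := le_iSup_max f i
  have hg := le_iSup_max g i
  have h1 := le_max_left (f i) 0
  have h2 := le_max_left (g i) 0
  exact max_le (by linarith) (add_nonneg (iSup_max_nonneg f) (iSup_max_nonneg g))

theorem iSup_max_mul {c : ℝ} (hc : 0 ≤ c) (f : Fin n → ℝ) :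
    (⨆ j, max (c * f j) 0) = c * ⨆ j, max (f j) 0 := by
  rw [Real.mul_iSup_of_nonneg hc]
  congr 1
  funext j
  rw [mul_max_of_nonneg _ _ hc, mul_zero]

/-- The formula above is a norm. -/
theorem normCore : NormedSpace.Core ℝ (MZ n) where
  norm_nonneg x := add_nonneg (iSup_max_nonneg _) (iSup_max_nonneg _)
  norm_smul c x := by
    change (⨆ j, max (c * (x : Fin n → ℝ) j) 0) + (⨆ j, max (-(c * (x : Fin n → ℝ) j)) 0) =
      |c| * ((⨆ j, max ((x : Fin n → ℝ) j) 0) + ⨆ j, max (-(x : Fin n → ℝ) j) 0)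
    rcases le_total 0 c with hc | hc
    · have h1 := iSup_max_mul hc (x : Fin n → ℝ)
      have h2 := iSup_max_mul hc (fun j => -(x : Fin n → ℝ) j)
      simp only [mul_neg] at h2
      rw [abs_of_nonneg hc, h1, h2, mul_add]
    · have hc' : 0 ≤ -c := neg_nonneg.2 hc
      have h1 := iSup_max_mul hc' (fun j => -(x : Fin n → ℝ) j)
      have h2 := iSup_max_mul hc' (x : Fin n → ℝ)
      simp only [neg_mul_neg] at h1
      simp only [neg_mul] at h2
      rw [abs_of_nonpos hc, h1, h2]
      ring
  norm_triangle x y := by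
    have h1 := iSup_max_add_le (x : Fin n → ℝ) (y : Fin n → ℝ)
    have h2 := iSup_max_add_le (fun j => -(x : Fin n → ℝ) j) (fun j => -(y : Fin n → ℝ) j)
    simp only [← neg_add] at h2
    change (⨆ j, max ((x : Fin n → ℝ) j + (y : Fin n → ℝ) j) 0) +
      (⨆ j, max (-((x : Fin n → ℝ) j + (y : Fin n → ℝ) j)) 0) ≤ _
    rw [norm_def, norm_def]
    linarith
  norm_eq_zero_iff x := by
    constructor
    · intro h
      rw [norm_def] at h
      have h1 := iSup_max_nonneg (x : Fin n → ℝ)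
      have h2 := iSup_max_nonneg (fun j => -(x : Fin n → ℝ) j)
      refine funext fun i => ?_
      have h3 := le_iSup_max (x : Fin n → ℝ) i
      have h4 := le_iSup_max (fun j => -(x : Fin n → ℝ) j) i
      have h5 := le_max_left ((x : Fin n → ℝ) i) 0
      have h6 := le_max_left (-(x : Fin n → ℝ) i) 0
      exact le_antisymm (show (x : Fin n → ℝ) i ≤ 0 by linarith)
        (show 0 ≤ (x : Fin n → ℝ) i by linarith)
    · rintro rfl
      change (⨆ j : Fin n, max (0 : ℝ) 0) + (⨆ j : Fin n, max (-(0 : ℝ)) 0) = 0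
      simp

noncomputable instance : NormedAddCommGroup (MZ n) := NormedAddCommGroup.ofCore normCore

noncomputable instance : NormedSpace ℝ (MZ n) := NormedSpace.ofCore normCore

end MZ

/-- A Steiner tree of a finite set `N` of points of a normed space `E`: a tree whose vertices are
finitely many points of `E`, among them all points of `N`. -/
structure SteinerTree {E : Type*} (N : Finset E) where
  /-- The vertex set of the tree. -/
  verts : Finset E
  /-- All given points are vertices. -/
  subset_verts : N ⊆ verts
  /-- The graph on the vertex set. -/
  graph : SimpleGraph verts
  /-- The graph is a tree. -/
  isTree : graph.IsTree

namespace SteinerTree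

variable {E : Type*}

open Classical in
/-- The length of a Steiner tree: the sum of `‖x - y‖` over its (unordered) edges `xy`. -/
noncomputable def length [NormedAddCommGroup E] {N : Finset E} (T : SteinerTree N) : ℝ :=
  ∑ e ∈ T.graph.edgeFinset,
    Sym2.lift ⟨fun x y : T.verts => ‖(x : E) - (y : E)‖, fun _ _ => norm_sub_rev _ _⟩ e

/-- A Steiner minimal tree (SMT) of `N`: a Steiner tree of `N` of minimum length among all Steiner
trees of `N`. -/
def IsSMT [NormedAddCommGroup E] {N : Finset E} (T : SteinerTree N) : Prop :=
  ∀ T' : SteinerTree N, T.length ≤ T'.length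

open Classical in
/-- The star joining `o` to the points of `A`, as a Steiner tree of `A ∪ {o}`: its vertices are the
points of `A ∪ {o}`, and its edges join `o` to every other vertex. -/
noncomputable def star (o : E) (A : Finset E) : SteinerTree (insert o A) where
  verts := insert o A
  subset_verts := Finset.Subset.refl _
  graph := SimpleGraph.starGraph ⟨o, Finset.mem_insert_self o A⟩
  isTree := SimpleGraph.isTree_starGraph _

end SteinerTree

/-! Adjoin a coordinate that is always `0`; the norm becomes the spread, largest minus smallest, of
the extended coordinates. So `x i - x j` is at most the norm of `x`, with equality iff `i ∈ top x`
and `j ∈ bot x`. The star on `A` is an SMT iff `A` is `Linked`, a condition on at most four points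
that passes to subsets; this gives the theorem.

Necessity (`linked_of_isSMT`): four points violating `Linked` allow an explicit shortening of the
star near `0`. Sufficiency (`isSMT_of_linked`): root any Steiner tree at `0` and collect terminals
towards the root. Each subtree carries a family of functionals `x i - x j`, or zero, bounding the
excess of its terminals' norms over its length. `Linked` lets such families telescope where subtrees
merge (`Calibrated.merge`), and at `0` every functional vanishes. -/

namespace SteinerTree

/-! ### Edges, lengths and step-by-step construction of Steiner trees -/

section Edges

variable {E : Type*}

open Classical in
/-- The edges of a Steiner tree, as unordered pairs of points of the space. -/
noncomputable def edges {N : Finset E} (T : SteinerTree N) : Finset (Sym2 E) :=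
  T.graph.edgeFinset.image (Sym2.map Subtype.val)

theorem mk_mem_edges {N : Finset E} (T : SteinerTree N) {x y : T.verts} :
    s((x : E), (y : E)) ∈ T.edges ↔ T.graph.Adj x y := by
  classical
  rw [edges, Finset.mem_image]
  constructor
  · rintro ⟨e, he, h⟩
    rw [← Sym2.map_mk, (Sym2.map.injective Subtype.val_injective).eq_iff] at h
    subst h
    simpa using he
  · intro h
    exact ⟨s(x, y), by simpa using h, rfl⟩

end Edges

section Length

variable {E : Type*} [NormedAddCommGroup E]

/-- The length of the segment joining an unordered pair of points. -/
def segmentLength : Sym2 E → ℝ :=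
  Sym2.lift ⟨fun x y : E => ‖x - y‖, fun _ _ => norm_sub_rev _ _⟩

theorem segmentLength_mk (x y : E) : segmentLength s(x, y) = ‖x - y‖ := rfl

theorem segmentLength_nonneg (e : Sym2 E) : 0 ≤ segmentLength e := by
  induction e with
  | _ x y => exact norm_nonneg (x - y)

theorem length_eq_sum_edges {N : Finset E} (T : SteinerTree N) :
    T.length = ∑ e ∈ T.edges, segmentLength e := by
  classical
  rw [edges, Finset.sum_image ((Sym2.map.injective Subtype.val_injective).injOn)]
  refine Finset.sum_congr (by congr) fun e _ => ?_
  induction e with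
  | _ x y => rfl

/-- A connected graph on finitely many points contains a Steiner tree that is not longer. -/
theorem exists_length_le_of_connected {N V : Finset E} (hNV : N ⊆ V) (F : Finset (Sym2 E))
    (hF : (SimpleGraph.fromEdgeSet {e : Sym2 V | e.map Subtype.val ∈ F}).Connected) :
    ∃ T : SteinerTree N, T.length ≤ ∑ e ∈ F, segmentLength e := by
  classical
  obtain ⟨H, hle, hH⟩ := hF.exists_isTree_le
  refine ⟨⟨V, hNV, H, hH⟩, ?_⟩
  rw [length_eq_sum_edges]
  refine Finset.sum_le_sum_of_subset_of_nonneg (fun e he => ?_) fun e _ _ => segmentLength_nonneg e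
  rw [edges, Finset.mem_image] at he
  obtain ⟨e', he', rfl⟩ := he
  have h1 : e' ∈ (SimpleGraph.fromEdgeSet {e : Sym2 V | e.map Subtype.val ∈ F}).edgeSet :=
    SimpleGraph.edgeSet_mono hle (by simpa using he')
  rw [SimpleGraph.edgeSet_fromEdgeSet] at h1
  exact h1.1

/-- There is a Steiner tree of `N` of length at most `l`. -/
def Spans (N : Finset E) (l : ℝ) : Prop :=
  ∃ T : SteinerTree N, T.length ≤ l

theorem Spans.mono {N N' : Finset E} {l l' : ℝ} (h : Spans N l) (hN : N' ⊆ N) (hl : l ≤ l') :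
    Spans N' l' := by
  obtain ⟨T, hT⟩ := h
  exact ⟨⟨T.verts, hN.trans T.subset_verts, T.graph, T.isTree⟩, hT.trans hl⟩

theorem spans_singleton (x : E) : Spans {x} 0 := by
  obtain ⟨T, hT⟩ := exists_length_le_of_connected (Finset.Subset.refl {x}) ∅
    ⟨fun u v => by rw [Subsingleton.elim u v]⟩
  exact ⟨T, by simpa using hT⟩

-- The new point may already be a vertex, so the added edge may close a cycle; passing to a spanning
-- tree repairs this without lengthening.
open Classical in
theorem Spans.insert {N : Finset E} {l : ℝ} (h : Spans N l) {x : E} (hx : x ∈ N) (y : E) :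
    Spans (insert y N) (l + ‖x - y‖) := by
  obtain ⟨T, hT⟩ := h
  have hxT := T.subset_verts hx
  by_cases hxy : x = y
  · subst hxy
    rw [Finset.insert_eq_of_mem hx]
    exact ⟨T, by simpa using hT⟩
  set F : Finset (Sym2 E) := Insert.insert s(x, y) T.edges with hFdef
  set V : Finset E := Insert.insert y T.verts with hVdef
  set G := SimpleGraph.fromEdgeSet {e : Sym2 V | e.map Subtype.val ∈ F} with hG
  have hsub : ∀ v : T.verts, (v : E) ∈ V := fun v => Finset.mem_insert_of_mem v.2
  let f : T.graph →g G :=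
    ⟨fun v => ⟨v, hsub v⟩, fun {a b} hab => by
      rw [hG, SimpleGraph.fromEdgeSet_adj]
      refine ⟨Finset.mem_insert_of_mem (T.mk_mem_edges.2 hab), fun h => hab.ne ?_⟩
      exact Subtype.ext (congrArg (fun u : V => (u : E)) h)⟩
  have hreach : ∀ v : V, G.Reachable (f ⟨x, hxT⟩) v := by
    rintro ⟨v, hv⟩
    rcases Finset.mem_insert.1 hv with rfl | hv'
    · refine SimpleGraph.Adj.reachable ?_
      refine (SimpleGraph.fromEdgeSet_adj _).2 ?_
      exact ⟨Finset.mem_insert_self _ _, fun h => hxy (congrArg (fun u : V => (u : E)) h)⟩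
    · exact (T.isTree.connected.preconnected ⟨x, hxT⟩ ⟨v, hv'⟩).map f
  have hconn : G.Connected := by
    have : Nonempty V := ⟨f ⟨x, hxT⟩⟩
    exact ⟨fun u v => (hreach u).symm.trans (hreach v)⟩
  obtain ⟨T', hT'⟩ := exists_length_le_of_connected
    (Finset.insert_subset_insert y T.subset_verts) F hconn
  refine ⟨T', hT'.trans ?_⟩
  rw [length_eq_sum_edges] at hT
  by_cases hmem : s(x, y) ∈ T.edges
  · rw [hFdef, Finset.insert_eq_of_mem hmem]
    linarith [norm_nonneg (x - y)]
  · rw [hFdef, Finset.sum_insert hmem, segmentLength_mk]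
    linarith

open Classical in
/-- Joining all points of `B` to a point of `N`. -/
theorem Spans.union {N : Finset E} {l : ℝ} (h : Spans N l) {x : E} (hx : x ∈ N) (B : Finset E) :
    Spans (N ∪ B) (l + ∑ b ∈ B, ‖x - b‖) := by
  induction B using Finset.induction_on with
  | empty => simpa using h
  | insert b B hb ih =>
    refine (ih.insert (Finset.mem_union_left _ hx) b).mono ?_ ?_
    · rw [Finset.union_insert]
    · rw [Finset.sum_insert hb]
      linarith

theorem star_length {A : Finset E} (hA : (0 : E) ∉ A) : (star 0 A).length = ∑ a ∈ A, ‖a‖ := by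
  classical
  have hE : (star 0 A).edges = A.image fun a => s(0, a) := by
    ext e
    rw [edges, Finset.mem_image, Finset.mem_image]
    constructor
    · rintro ⟨e', he', rfl⟩
      induction e' with
      | _ x y =>
        rw [SimpleGraph.mem_edgeFinset, SimpleGraph.mem_edgeSet] at he'
        obtain ⟨hne, h⟩ := SimpleGraph.starGraph_adj.1 he'
        rcases h with rfl | rfl
        · exact ⟨y, Finset.mem_of_mem_insert_of_ne y.2 fun h => hne (Subtype.ext h.symm), rfl⟩
        · exact ⟨x, Finset.mem_of_mem_insert_of_ne x.2 fun h => hne (Subtype.ext h), Sym2.eq_swap⟩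
    · rintro ⟨a, ha, rfl⟩
      refine ⟨s(⟨0, Finset.mem_insert_self 0 A⟩, ⟨a, Finset.mem_insert_of_mem ha⟩), ?_, rfl⟩
      rw [SimpleGraph.mem_edgeFinset, SimpleGraph.mem_edgeSet]
      refine SimpleGraph.starGraph_adj.2 ⟨fun h => hA ?_, Or.inl rfl⟩
      have h' : (0 : E) = a := congrArg Subtype.val h
      rwa [h']
  rw [length_eq_sum_edges, hE, Finset.sum_image]
  · exact Finset.sum_congr rfl fun a _ => by rw [segmentLength_mk, zero_sub, norm_neg]
  · intro a _ b _ h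
    exact Sym2.congr_right.1 h

theorem star_isSMT_iff {A : Finset E} (hA : (0 : E) ∉ A) :
    (star 0 A).IsSMT ↔ ∀ T : SteinerTree (star 0 A).verts, ∑ a ∈ A, ‖a‖ ≤ T.length := by
  rw [IsSMT, star_length hA]
  rfl

end Length

/-! ### Induction along a rooted tree -/

section Accumulate

/-- Collecting data along a rooted forest towards the root: `P B x l` is a property of a set `B` of
points, a current position `x` and a length `l`, stable under moving and under merging. -/
theorem accumulate_of_parent {E V : Type*} [NormedAddCommGroup E] [DecidableEq E]
    [DecidableEq V] {P : Finset E → E → ℝ → Prop}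
    (hmove : ∀ B x y l, P B x l → P B y (l + ‖x - y‖))
    (hmerge : ∀ B C x l l', Disjoint B C → P B x l → P C x l' → P (B ∪ C) x (l + l'))
    (p : V → E) (r : V) (d : V → ℕ) (par : V → V) (hpar : ∀ v, v ≠ r → d (par v) < d v)
    (S : Finset V) (hr : r ∈ S) (hS : ∀ v ∈ S, v ≠ r → par v ∈ S)
    (B : V → Finset E) (l : V → ℝ) (hP : ∀ v ∈ S, P (B v) (p v) (l v))
    (hB : (S : Set V).PairwiseDisjoint B) :
    P (S.biUnion B) (p r) (∑ v ∈ S, l v + ∑ v ∈ S.erase r, ‖p v - p (par v)‖) := by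
  induction hn : S.card using Nat.strong_induction_on generalizing S B l with
  | _ m ih =>
    subst hn
    rcases (S.erase r).eq_empty_or_nonempty with hem | hne
    · have hSr : S = {r} := by
        rw [← Finset.insert_erase hr, hem, insert_empty_eq]
      subst hSr
      simpa using hP r hr
    -- A vertex of maximal depth is the parent of no remaining vertex, so it can be pruned and its
    -- data merged into its parent.
    obtain ⟨v, hv, hmax⟩ := Finset.exists_max_image (S.erase r) d hne
    obtain ⟨hvr, hvS⟩ := Finset.mem_erase.1 hv
    set w := par v with hw
    have hwS : w ∈ S := hS v hvS hvr
    have hwv : w ≠ v := fun h => (hpar v hvr).ne (by rw [← hw, h])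
    have hwS' : w ∈ S.erase v := Finset.mem_erase.2 ⟨hwv, hwS⟩
    have hrS' : r ∈ S.erase v := Finset.mem_erase.2 ⟨hvr.symm, hr⟩
    have key := ih (S.erase v).card (Finset.card_erase_lt_of_mem hvS) (S.erase v) hrS'
      (fun u hu hur => by
        obtain ⟨huv, huS⟩ := Finset.mem_erase.1 hu
        refine Finset.mem_erase.2 ⟨fun h => ?_, hS u huS hur⟩
        have h1 := hpar u hur
        rw [h] at h1
        exact absurd (hmax u (Finset.mem_erase.2 ⟨hur, huS⟩)) (not_le.2 h1))
      (Function.update B w (B w ∪ B v)) (Function.update l w (l w + (l v + ‖p v - p w‖)))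
      (fun u hu => by
        by_cases huw : u = w
        · subst huw
          rw [Function.update_self, Function.update_self]
          exact hmerge _ _ _ _ _ (hB hwS hvS hwv) (hP _ hwS) (hmove _ _ _ _ (hP v hvS))
        · rw [Function.update_of_ne huw, Function.update_of_ne huw]
          exact hP u (Finset.mem_of_mem_erase hu))
      (by
        intro a ha b hb hab
        obtain ⟨hav, haS⟩ := Finset.mem_erase.1 (Finset.mem_coe.1 ha)
        obtain ⟨hbv, hbS⟩ := Finset.mem_erase.1 (Finset.mem_coe.1 hb)
        simp only [Function.onFun]
        by_cases haw : a = w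
        · subst haw
          rw [Function.update_self, Function.update_of_ne hab.symm]
          exact Finset.disjoint_union_left.2 ⟨hB haS hbS hab, hB hvS hbS hbv.symm⟩
        · rw [Function.update_of_ne haw]
          by_cases hbw : b = w
          · subst hbw
            rw [Function.update_self]
            exact Finset.disjoint_union_right.2 ⟨hB haS hbS hab, hB haS hvS hav⟩
          · rw [Function.update_of_ne hbw]
            exact hB haS hbS hab)
      rfl
    have hU : (S.erase v).biUnion (Function.update B w (B w ∪ B v)) = S.biUnion B := by
      ext e
      simp only [Finset.mem_biUnion, Finset.mem_erase]
      constructor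
      · rintro ⟨u, ⟨huv, huS⟩, he⟩
        by_cases huw : u = w
        · subst huw
          rw [Function.update_self, Finset.mem_union] at he
          exact he.elim (fun h => ⟨_, hwS, h⟩) fun h => ⟨v, hvS, h⟩
        · rw [Function.update_of_ne huw] at he
          exact ⟨u, huS, he⟩
      · rintro ⟨u, huS, he⟩
        by_cases huv : u = v
        · subst huv
          exact ⟨w, ⟨hwv, hwS⟩, by rw [Function.update_self]; exact Finset.mem_union_right _ he⟩
        · refine ⟨u, ⟨huv, huS⟩, ?_⟩
          by_cases huw : u = w
          · subst huw
            rw [Function.update_self]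
            exact Finset.mem_union_left _ he
          · rwa [Function.update_of_ne huw]
    have hl : ∑ u ∈ S.erase v, Function.update l w (l w + (l v + ‖p v - p w‖)) u =
        ∑ u ∈ S, l u + ‖p v - p w‖ := by
      rw [Finset.sum_update_of_mem hwS', ← Finset.add_sum_erase S l hvS,
        ← Finset.add_sum_erase (S.erase v) l hwS', Finset.sdiff_singleton_eq_erase]
      ring
    have hd : ∑ u ∈ S.erase r, ‖p u - p (par u)‖ =
        ‖p v - p w‖ + ∑ u ∈ (S.erase v).erase r, ‖p u - p (par u)‖ := by
      rw [← Finset.add_sum_erase _ _ hv, Finset.erase_right_comm]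
    rw [hU, hl] at key
    rw [hd]
    convert key using 1
    ring

open Classical in
/-- A property of sets of points that can be moved and merged holds for all terminals of a Steiner
tree, at any vertex of the tree. -/
theorem accumulate {E : Type*} [NormedAddCommGroup E] {P : Finset E → E → ℝ → Prop}
    (hle : ∀ B x l l', l ≤ l' → P B x l → P B x l')
    (hmove : ∀ B x y l, P B x l → P B y (l + ‖x - y‖))
    (hmerge : ∀ B C x l l', Disjoint B C → P B x l → P C x l' → P (B ∪ C) x (l + l'))
    {N A : Finset E} (T : SteinerTree N) (hAN : A ⊆ N)
    (hempty : ∀ x, P ∅ x 0) (hsingle : ∀ a ∈ A, P {a} a 0) {o : E} (ho : o ∈ N) :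
    P A o T.length := by
  have hc := T.isTree.connected
  set r : T.verts := ⟨o, T.subset_verts ho⟩ with hrdef
  have hex : ∀ v : T.verts, ∃ w, v ≠ r → T.graph.Adj v w ∧ T.graph.dist w r < T.graph.dist v r := by
    intro v
    by_cases hv : v = r
    · exact ⟨v, fun h => absurd hv h⟩
    obtain ⟨q, hq⟩ := hc.exists_walk_length_eq_dist v r
    cases q with
    | nil => exact absurd rfl hv
    | @cons _ w _ h q' =>
      refine ⟨w, fun _ => ⟨h, ?_⟩⟩
      rw [← hq, SimpleGraph.Walk.length_cons]
      exact Nat.lt_succ_of_le (SimpleGraph.dist_le q')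
  choose par hpar using hex
  set B : T.verts → Finset E := fun v => if (v : E) ∈ A then {(v : E)} else ∅ with hBdef
  have key := accumulate_of_parent hmove hmerge (fun v : T.verts => (v : E)) r
    (fun v => T.graph.dist v r) par (fun v hv => (hpar v hv).2) Finset.univ (Finset.mem_univ _)
    (fun _ _ _ => Finset.mem_univ _) B (fun _ => 0)
    (fun v _ => by
      simp only [hBdef]
      split_ifs with h
      · exact hsingle v h
      · exact hempty v)
    (by
      intro a _ b _ hab
      have h : (a : E) ≠ b := fun h => hab (Subtype.ext h)
      simp only [Function.onFun, hBdef]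
      split_ifs <;> simp [h])
  have hU : Finset.univ.biUnion B = A := by
    ext e
    simp only [Finset.mem_biUnion, Finset.mem_univ, true_and, hBdef]
    constructor
    · rintro ⟨v, hv⟩
      split_ifs at hv with h
      · rwa [Finset.mem_singleton.1 hv]
      · simp at hv
    · intro he
      exact ⟨⟨e, T.subset_verts (hAN he)⟩, by simp [he]⟩
  rw [hU] at key
  refine hle _ _ _ _ ?_ key
  rw [Finset.sum_const_zero, zero_add, length_eq_sum_edges]
  -- Two vertices cannot be each other's parents, as the distance to the root drops; so parent edges
  -- are distinct edges of `T`.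
  have hinj : Set.InjOn (fun v : T.verts => s((v : E), (par v : E)))
      ((Finset.univ.erase r : Finset T.verts) : Set T.verts) := by
    intro v hv w hw h
    have hv' := (hpar v (Finset.ne_of_mem_erase hv)).2
    have hw' := (hpar w (Finset.ne_of_mem_erase hw)).2
    rcases Sym2.eq_iff.1 h with ⟨h1, _⟩ | ⟨h1, h2⟩
    · exact Subtype.ext h1
    · rw [Subtype.ext h2] at hv'
      rw [← Subtype.ext h1] at hw'
      omega
  refine (Finset.sum_image (f := segmentLength) hinj).symm.le.trans ?_
  refine Finset.sum_le_sum_of_subset_of_nonneg (fun e he => ?_) fun e _ _ => segmentLength_nonneg e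
  obtain ⟨v, hv, rfl⟩ := Finset.mem_image.1 he
  exact T.mk_mem_edges.2 (hpar v (Finset.ne_of_mem_erase hv)).1

end Accumulate

end SteinerTree

/-! ### The norm as a spread of extended coordinates -/

namespace MZ

variable {n : ℕ}

/-- The coordinates of a point of `M_Z^n`, with an additional coordinate `0`. -/
def coord (x : MZ n) : Option (Fin n) → ℝ
  | none => 0
  | some i => (x : Fin n → ℝ) i

theorem coord_zero (i : Option (Fin n)) : coord (0 : MZ n) i = 0 := by
  cases i <;> rfl

theorem coord_sub (x y : MZ n) (i : Option (Fin n)) :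
    coord (x - y) i = coord x i - coord y i := by
  cases i with
  | none => exact (sub_zero (0 : ℝ)).symm
  | some i => rfl

theorem coord_smul (c : ℝ) (x : MZ n) (i : Option (Fin n)) :
    coord (c • x) i = c * coord x i := by
  cases i with
  | none => exact (mul_zero c).symm
  | some i => rfl

/-- The norm of `M_Z^n` is the spread of the extended coordinates. -/
theorem norm_le_of_coord_sub_le {x : MZ n} {c : ℝ} (h : ∀ i j, coord x i - coord x j ≤ c) :
    ‖x‖ ≤ c := by
  have h2 : ∀ i, (⨆ j : Fin n, max (-(x : Fin n → ℝ) j) 0) ≤ c - coord x i := fun i => by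
    have h0 := h i none
    simp only [coord, sub_zero] at h0
    refine Real.iSup_le (fun j => max_le ?_ ?_) ?_
    · have := h i (some j)
      simp only [coord] at this ⊢
      linarith
    all_goals
      simp only [coord]
      linarith
  have h1 : (⨆ i : Fin n, max ((x : Fin n → ℝ) i) 0) ≤
      c - ⨆ j : Fin n, max (-(x : Fin n → ℝ) j) 0 := by
    have h0 := h2 none
    simp only [coord, sub_zero] at h0
    refine Real.iSup_le (fun i => max_le ?_ ?_) ?_
    · have := h2 (some i)
      simp only [coord] at this
      linarith
    all_goals linarith
  rw [norm_def]
  linarith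

theorem coord_sub_coord_le_norm (x : MZ n) (i j : Option (Fin n)) :
    coord x i - coord x j ≤ ‖x‖ := by
  have h1 : coord x i ≤ ⨆ i : Fin n, max ((x : Fin n → ℝ) i) 0 := by
    cases i with
    | none => exact iSup_max_nonneg _
    | some i => exact (le_max_left _ _).trans (le_iSup_max (x : Fin n → ℝ) i)
  have h2 : -coord x j ≤ ⨆ j : Fin n, max (-(x : Fin n → ℝ) j) 0 := by
    cases j with
    | none => exact neg_zero.le.trans (iSup_max_nonneg fun j => -(x : Fin n → ℝ) j)
    | some j => exact (le_max_left _ _).trans (le_iSup_max (fun j => -(x : Fin n → ℝ) j) j)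
  rw [norm_def]
  linarith

/-- The indices at which a point has its largest coordinate. -/
def top (x : MZ n) : Set (Option (Fin n)) := {i | ∀ j, coord x j ≤ coord x i}

/-- The indices at which a point has its smallest coordinate. -/
def bot (x : MZ n) : Set (Option (Fin n)) := {i | ∀ j, coord x i ≤ coord x j}

theorem top_nonempty (x : MZ n) : (top x).Nonempty := Finite.exists_max (coord x)

theorem bot_nonempty (x : MZ n) : (bot x).Nonempty := Finite.exists_min (coord x)

theorem norm_eq_coord_sub {x : MZ n} {i j : Option (Fin n)} (hi : i ∈ top x) (hj : j ∈ bot x) :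
    ‖x‖ = coord x i - coord x j :=
  le_antisymm (norm_le_of_coord_sub_le fun k l => sub_le_sub (hi k) (hj l))
    (coord_sub_coord_le_norm x i j)

theorem coord_sub_lt_norm {x : MZ n} {i j : Option (Fin n)} (h : ¬(i ∈ top x ∧ j ∈ bot x)) :
    coord x i - coord x j < ‖x‖ := by
  refine lt_of_le_of_ne (coord_sub_coord_le_norm x i j) fun he => h ⟨fun k => ?_, fun k => ?_⟩
  · have := coord_sub_coord_le_norm x k j
    linarith
  · have := coord_sub_coord_le_norm x i k
    linarith

/-- The largest coordinate of `b` occurs at an index at which `a` has its smallest coordinate. -/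
def Meets (b a : MZ n) : Prop := (top b ∩ bot a).Nonempty

theorem not_meets_self {a : MZ n} (ha : a ≠ 0) : ¬Meets a a := by
  rintro ⟨i, hi, hj⟩
  have := norm_eq_coord_sub hi hj
  rw [sub_self, norm_eq_zero] at this
  exact ha this

/-- The point with extended coordinates `y`, up to an additive constant. -/
def ofCoord (y : Option (Fin n) → ℝ) : MZ n := fun i => y (some i) - y none

theorem coord_ofCoord (y : Option (Fin n) → ℝ) (i : Option (Fin n)) :
    coord (ofCoord y) i = y i - y none := by
  cases i with
  | none => exact (sub_self _).symm
  | some i => rfl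

/-- Attained coordinate differences that are not the largest ones stay away from the norm. -/
def HasGap (x : MZ n) (ε : ℝ) : Prop :=
  ∀ i j, coord x i - coord x j < ‖x‖ → coord x i - coord x j + 3 * ε ≤ ‖x‖

open Filter Topology in
theorem eventually_hasGap (x : MZ n) : ∀ᶠ ε in 𝓝[>] (0 : ℝ), HasGap x ε := by
  refine eventually_all.2 fun i => eventually_all.2 fun j => ?_
  by_cases h : coord x i - coord x j < ‖x‖
  · have hpos : 0 < (‖x‖ - (coord x i - coord x j)) / 3 := by linarith
    filter_upwards [Ioo_mem_nhdsGT hpos] with ε hε _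
    have := hε.2
    linarith
  · exact Eventually.of_forall fun ε h' => absurd h' h

/-- Extremal differences of `x` drop by at least `ε`. The others grow by at most `2 * ε`, since `y`
lies in `[0, 2]`; the gap `3 * ε` absorbs this. -/
theorem norm_sub_smul_ofCoord_le {x : MZ n} {ε : ℝ} (hε : 0 ≤ ε) (hx : HasGap x ε)
    {y : Option (Fin n) → ℝ} (h0 : ∀ i, 0 ≤ y i) (h2 : ∀ i, y i ≤ 2) (c : ℝ)
    (htop : ∀ i ∈ top x, c + 1 ≤ y i) (hbot : ∀ i ∈ bot x, y i ≤ c) :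
    ‖ε • ofCoord y - x‖ ≤ ‖x‖ - ε := by
  rw [norm_sub_rev]
  refine norm_le_of_coord_sub_le fun i j => ?_
  simp only [coord_sub, coord_smul, coord_ofCoord]
  by_cases h : i ∈ top x ∧ j ∈ bot x
  · have h1 := mul_le_mul_of_nonneg_left (sub_le_sub (htop i h.1) (hbot j h.2)) hε
    have h3 := norm_eq_coord_sub h.1 h.2
    linarith
  · have h1 := hx i j (coord_sub_lt_norm h)
    have h3 := mul_le_mul_of_nonneg_left (sub_le_sub (h2 j) (h0 i)) hε
    linarith

theorem norm_smul_ofCoord_sub_le {ε : ℝ} (hε : 0 ≤ ε) {y z : Option (Fin n) → ℝ}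
    (h : ∀ i j, (y i - z i) - (y j - z j) ≤ 1) : ‖ε • ofCoord y - ε • ofCoord z‖ ≤ ε := by
  refine norm_le_of_coord_sub_le fun i j => ?_
  simp only [coord_sub, coord_smul, coord_ofCoord]
  have := mul_le_mul_of_nonneg_left (h i j) hε
  linarith

/-! ### Necessity: shortening a star that is not linked -/

open SteinerTree

open Classical in
/-- Two points can be joined, via one more Steiner point, to a Steiner point close to `0`, at a cost
smaller than the sum of their norms. -/
theorem spans_union_pair {N : Finset (MZ n)} {l ε : ℝ} (hε : 0 ≤ ε) {U : Set (Option (Fin n))}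
    (hN : Spans N l) (hU : ε • ofCoord (U.indicator 1) ∈ N) {a b : MZ n} (ha : a ≠ 0) (hb : b ≠ 0)
    (hga : HasGap a ε) (hgb : HasGap b ε) (hbU : top b ⊆ U) (haU : Disjoint (bot a) U) :
    Spans (N ∪ {a, b}) (l + ∑ p ∈ {a, b}, ‖p‖ - ε) := by
  -- A single terminal is joined directly: an extra Steiner point would cost the `ε` that it saves.
  by_cases hab : a = b
  · subst hab
    refine (hN.union hU {a, a}).mono (Finset.Subset.refl _) ?_
    have := norm_sub_smul_ofCoord_le hε hga (y := U.indicator 1)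
      (fun i => Set.indicator_nonneg (fun _ _ => zero_le_one) i)
      (fun i => (Set.indicator_le_self' (fun _ _ => zero_le_one) i).trans one_le_two) 0
      (fun i hi => by simp [hbU hi])
      (fun i hi => by simp [Set.disjoint_left.1 haU hi])
    simp only [Finset.pair_eq_singleton, Finset.sum_singleton]
    linarith
  -- `y` is `0` on `bot a`, `2` on `top b` and `1` elsewhere. Moving to it saves `ε` for each of `a`
  -- and `b`, and it lies within `ε` of the point of `U`: net saving `ε`.
  set y : Option (Fin n) → ℝ := (bot a)ᶜ.indicator 1 + (top b).indicator 1 with hy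
  have hna : ∀ i ∈ bot a, i ∉ top b := fun i hi h => Set.disjoint_left.1 haU hi (hbU h)
  have htb : ∀ i ∈ top b, i ∉ bot a := fun i hi h => hna i h hi
  have hyb : ∀ i, i ∈ bot a → y i = 0 := fun i hi => by simp [hy, hi, hna i hi]
  have hyt : ∀ i, i ∈ top b → y i = 2 := fun i hi => by
    simp only [hy, Pi.add_apply, Set.indicator_of_mem hi,
      Set.indicator_of_mem (show i ∈ (bot a)ᶜ from htb i hi), Pi.one_apply]
    norm_num
  have hym : ∀ i, i ∉ bot a → i ∉ top b → y i = 1 := fun i hi hi' => by simp [hy, hi, hi']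
  have hy0 : ∀ i, 0 ≤ y i ∧ y i ≤ 2 := fun i => by
    by_cases h1 : i ∈ bot a
    · simp [hyb i h1]
    by_cases h2 : i ∈ top b
    · simp [hyt i h2]
    · rw [hym i h1 h2]
      norm_num
  have hna' : ‖ε • ofCoord y - a‖ ≤ ‖a‖ - ε := by
    refine norm_sub_smul_ofCoord_le hε hga (fun i => (hy0 i).1) (fun i => (hy0 i).2) 0
      (fun i hi => ?_) fun i hi => (hyb i hi).le
    have h1 : i ∉ bot a := fun h => not_meets_self ha ⟨i, hi, h⟩
    by_cases h2 : i ∈ top b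
    · rw [hyt i h2]
      norm_num
    · rw [hym i h1 h2]
      norm_num
  have hnb' : ‖ε • ofCoord y - b‖ ≤ ‖b‖ - ε := by
    refine norm_sub_smul_ofCoord_le hε hgb (fun i => (hy0 i).1) (fun i => (hy0 i).2) 1
      (fun i hi => ?_) fun i hi => ?_
    · rw [hyt i hi]
      norm_num
    · have h2 : i ∉ top b := fun h => not_meets_self hb ⟨i, h, hi⟩
      by_cases h1 : i ∈ bot a
      · rw [hyb i h1]
        norm_num
      · rw [hym i h1 h2]
  have hd : ∀ i, 0 ≤ y i - U.indicator 1 i ∧ y i - U.indicator 1 i ≤ 1 := fun i => by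
    by_cases h1 : i ∈ bot a
    · simp [hyb i h1, Set.disjoint_left.1 haU h1]
    by_cases h2 : i ∈ top b
    · rw [hyt i h2, Set.indicator_of_mem (hbU h2)]
      norm_num
    · rw [hym i h1 h2]
      by_cases h3 : i ∈ U <;> simp [h3]
  have hn := norm_smul_ofCoord_sub_le hε (y := U.indicator 1) (z := y) fun i j => by
    have h1 := (hd i).1
    have h2 := (hd j).2
    linarith
  refine ((hN.insert hU (ε • ofCoord y)).union (Finset.mem_insert_self _ _) {a, b}).mono
    (Finset.union_subset_union_left (Finset.subset_insert _ _)) ?_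
  rw [Finset.sum_pair hab, Finset.sum_pair hab]
  linarith

/-- The combinatorial condition that characterizes the stars that are Steiner minimal trees. -/
def Linked (A : Finset (MZ n)) : Prop :=
  ∀ a ∈ A, ∀ b ∈ A, ∀ c ∈ A, ∀ d ∈ A, a ≠ c → a ≠ d → b ≠ c → b ≠ d →
    ¬Meets b a → ¬Meets d c → Meets b c ∨ Meets d a

/-- If `Linked` fails, `top b ∪ top d` misses `bot a ∪ bot c`, so one point `s` serves both pairs.
Each pair saves `ε` and joining `0` to `s` costs at most `ε`, so the star is not minimal. -/
theorem linked_of_isSMT {A : Finset (MZ n)} (hA : (0 : MZ n) ∉ A) (h : (star 0 A).IsSMT) :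
    Linked A := by
  classical
  intro a ha b hb c hc d hd hac had hbc hbd hba hdc
  by_contra hcon
  obtain ⟨hbc', hda'⟩ := not_or.1 hcon
  have hne : ∀ p ∈ A, p ≠ 0 := fun p hp h0 => hA (h0 ▸ hp)
  obtain ⟨ε, ⟨hga, hgb, hgc, hgd⟩, hε⟩ := ((eventually_hasGap a).and ((eventually_hasGap b).and
    ((eventually_hasGap c).and (eventually_hasGap d))) |>.and self_mem_nhdsWithin).exists
  have hε : 0 < ε := hε
  set U := top b ∪ top d with hU
  have haU : Disjoint (bot a) U := Set.disjoint_left.2 fun i hi h =>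
    h.elim (fun h => hba ⟨i, h, hi⟩) fun h => hda' ⟨i, h, hi⟩
  have hcU : Disjoint (bot c) U := Set.disjoint_left.2 fun i hi h =>
    h.elim (fun h => hbc' ⟨i, h, hi⟩) fun h => hdc ⟨i, h, hi⟩
  set s : MZ n := ε • ofCoord (U.indicator 1) with hs
  have hsn : ‖(0 : MZ n) - s‖ ≤ ε := by
    have := norm_smul_ofCoord_sub_le (n := n) hε.le (y := 0) (z := U.indicator 1) fun i j => by
      by_cases h1 : i ∈ U <;> by_cases h2 : j ∈ U <;> simp [h1, h2]
    have h0 : ofCoord (0 : Option (Fin n) → ℝ) = 0 := funext fun i => sub_self (0 : ℝ)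
    rwa [h0, smul_zero] at this
  have h0 := (spans_singleton (0 : MZ n)).insert (Finset.mem_singleton_self _) s
  have h1 := spans_union_pair hε.le h0 (Finset.mem_insert_self _ _) (hne a ha) (hne b hb) hga hgb
    Set.subset_union_left haU
  have h2 := spans_union_pair hε.le h1
    (Finset.mem_union_left _ (Finset.mem_insert_self _ _)) (hne c hc) (hne d hd) hgc hgd
    Set.subset_union_right hcU
  have h3 := h2.union (x := 0) (by simp) (A \ ({a, b} ∪ {c, d}))
  have hsub : ({a, b} ∪ {c, d} : Finset (MZ n)) ⊆ A := by
    intro p hp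
    simp only [Finset.mem_union, Finset.mem_insert, Finset.mem_singleton] at hp
    rcases hp with (rfl | rfl) | rfl | rfl <;> assumption
  have hdisj : Disjoint ({a, b} : Finset (MZ n)) {c, d} := by
    simp only [Finset.disjoint_insert_left, Finset.disjoint_singleton_left, Finset.mem_insert,
      Finset.mem_singleton]
    tauto
  have hsum := Finset.sum_sdiff (f := fun p : MZ n => ‖p‖) hsub
  rw [Finset.sum_union hdisj] at hsum
  simp only [zero_sub, norm_neg] at h3 hsn
  obtain ⟨T, hT⟩ := h3.mono (N' := (star 0 A).verts) (by
    intro p hp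
    rcases Finset.mem_insert.1 hp with rfl | hp
    · simp
    · by_cases hp' : p ∈ ({a, b} ∪ {c, d} : Finset (MZ n))
      · simp only [Finset.mem_union] at hp' ⊢
        tauto
      · exact Finset.mem_union_right _ (Finset.mem_sdiff.2 ⟨hp, hp'⟩)) le_rfl
  have := (star_isSMT_iff hA).1 h T
  linarith

/-! ### Sufficiency: calibration by coordinate differences -/

/-- The property of a subtree with root `x`, length `l` and terminals `B ⊆ A` from which the
minimality of the star is deduced: the norms of its terminals are calibrated either by the zero
functional, or by all functionals that norm a certain pair of terminals. -/
def Calibrated (A B : Finset (MZ n)) (x : MZ n) (l : ℝ) : Prop :=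
  B ⊆ A ∧ (∑ p ∈ B, ‖p‖ ≤ l ∨ ∃ a ∈ B, ∃ b ∈ B, ¬Meets b a ∧
    ∀ i ∈ top b, ∀ j ∈ bot a, ∑ p ∈ B, ‖p‖ ≤ l + (coord x i - coord x j))

theorem Calibrated.mono {A B : Finset (MZ n)} {x : MZ n} {l l' : ℝ} (hl : l ≤ l')
    (h : Calibrated A B x l) : Calibrated A B x l' := by
  refine ⟨h.1, h.2.imp (fun h => h.trans hl) ?_⟩
  rintro ⟨a, ha, b, hb, hab, h⟩
  exact ⟨a, ha, b, hb, hab, fun i hi j hj => (h i hi j hj).trans (by linarith)⟩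

theorem Calibrated.move {A B : Finset (MZ n)} {x : MZ n} (y : MZ n) {l : ℝ}
    (h : Calibrated A B x l) : Calibrated A B y (l + ‖x - y‖) := by
  refine ⟨h.1, h.2.imp (fun h => h.trans (le_add_of_nonneg_right (norm_nonneg _))) ?_⟩
  rintro ⟨a, ha, b, hb, hab, h⟩
  refine ⟨a, ha, b, hb, hab, fun i hi j hj => (h i hi j hj).trans ?_⟩
  have := coord_sub_coord_le_norm (x - y) i j
  simp only [coord_sub] at this
  linarith

-- An index `k` in `top b ∩ bot c` turns the sum of `x k - x j` and `x i - x k` into `x i - x j`,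
-- leaving the pair `a`, `d`. If `top d` meets `bot a` too, everything cancels and the zero
-- functional remains. `Linked` excludes the case where neither meeting occurs; disjointness of `B`
-- and `C` gives its inequalities.
open Classical in
theorem Calibrated.merge {A B C : Finset (MZ n)} (hA : Linked A) {x : MZ n} {l l' : ℝ}
    (hBC : Disjoint B C) (hB : Calibrated A B x l) (hC : Calibrated A C x l') :
    Calibrated A (B ∪ C) x (l + l') := by
  obtain ⟨hBA, hB⟩ := hB
  obtain ⟨hCA, hC⟩ := hC
  refine ⟨Finset.union_subset hBA hCA, ?_⟩
  rw [Finset.sum_union hBC]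
  rcases hB with hB | ⟨a, ha, b, hb, hba, hB⟩
  · rcases hC with hC | ⟨c, hc, d, hd, hdc, hC⟩
    · exact Or.inl (add_le_add hB hC)
    · refine Or.inr ⟨c, Finset.mem_union_right _ hc, d, Finset.mem_union_right _ hd, hdc,
        fun i hi j hj => ?_⟩
      have := hC i hi j hj
      linarith
  · rcases hC with hC | ⟨c, hc, d, hd, hdc, hC⟩
    · refine Or.inr ⟨a, Finset.mem_union_left _ ha, b, Finset.mem_union_left _ hb, hba,
        fun i hi j hj => ?_⟩
      have := hB i hi j hj
      linarith
    · have hne : ∀ p ∈ B, ∀ q ∈ C, p ≠ q := fun p hp q hq => Finset.disjoint_iff_ne.1 hBC p hp q hq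
      have hlink := hA a (hBA ha) b (hBA hb) c (hCA hc) d (hCA hd) (hne a ha c hc) (hne a ha d hd)
        (hne b hb c hc) (hne b hb d hd) hba hdc
      by_cases hbc : Meets b c
      · obtain ⟨k, hkb, hkc⟩ := hbc
        by_cases hda : Meets d a
        · obtain ⟨m, hmd, hma⟩ := hda
          have h1 := hB k hkb m hma
          have h2 := hC m hmd k hkc
          exact Or.inl (by linarith)
        · refine Or.inr ⟨a, Finset.mem_union_left _ ha, d, Finset.mem_union_right _ hd, hda,
            fun i hi j hj => ?_⟩
          have h1 := hB k hkb j hj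
          have h2 := hC i hi k hkc
          linarith
      · obtain ⟨k, hkd, hka⟩ := hlink.resolve_left hbc
        refine Or.inr ⟨c, Finset.mem_union_right _ hc, b, Finset.mem_union_left _ hb, hbc,
          fun i hi j hj => ?_⟩
        have h1 := hB i hi k hka
        have h2 := hC k hkd j hj
        linarith

theorem isSMT_of_linked {A : Finset (MZ n)} (hA : (0 : MZ n) ∉ A) (h : Linked A) :
    (star 0 A).IsSMT := by
  classical
  refine (star_isSMT_iff hA).2 fun T => ?_
  have key : Calibrated A A 0 T.length :=
    T.accumulate (P := Calibrated A) (fun _ _ _ _ hl h => h.mono hl) (fun _ _ y _ h => h.move y)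
      (fun _ _ _ _ _ hBC hB hC => hB.merge h hBC hC) (Finset.subset_insert 0 A)
      (fun x => ⟨Finset.empty_subset _, Or.inl (by simp)⟩)
      -- A terminal starts with the pair `a`, `a`, whose functionals norm it exactly.
      (fun a ha => ⟨Finset.singleton_subset_iff.2 ha, Or.inr ⟨a, Finset.mem_singleton_self a, a,
        Finset.mem_singleton_self a, not_meets_self fun h0 => hA (h0 ▸ ha), fun i hi j hj => by
          rw [Finset.sum_singleton, norm_eq_coord_sub hi hj, zero_add]⟩⟩)
      (Finset.mem_insert_self 0 A)
  rcases key.2 with hl | ⟨a, _, b, _, _, hl⟩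
  · exact hl
  · obtain ⟨i, hi⟩ := top_nonempty b
    obtain ⟨j, hj⟩ := bot_nonempty a
    simpa [coord_zero] using hl i hi j hj

end MZ

theorem corollary2 (n : ℕ) (A : Finset (MZ n)) (hA : ∀ a ∈ A, a ≠ 0) :
    (SteinerTree.star 0 A).IsSMT ↔
      ∀ B : Finset (MZ n), B ⊆ A → B.card ≤ 4 → (SteinerTree.star 0 B).IsSMT := by
  classical
  have h0 : ∀ B ⊆ A, (0 : MZ n) ∉ B := fun B hB h => hA 0 (hB h) rfl
  constructor
  · intro h B hB _
    have hl := MZ.linked_of_isSMT (h0 A (Finset.Subset.refl A)) h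
    exact MZ.isSMT_of_linked (h0 B hB) fun a ha b hb c hc d hd =>
      hl a (hB ha) b (hB hb) c (hB hc) d (hB hd)
  · intro h
    refine MZ.isSMT_of_linked (h0 A (Finset.Subset.refl A)) fun a ha b hb c hc d hd => ?_
    have hB : ({a, b, c, d} : Finset (MZ n)) ⊆ A := by
      intro p hp
      simp only [Finset.mem_insert, Finset.mem_singleton] at hp
      rcases hp with rfl | rfl | rfl | rfl <;> assumption
    exact MZ.linked_of_isSMT (h0 _ hB) (h _ hB Finset.card_le_four) a (by simp) b (by simp)
      c (by simp) d (by simp)
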